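/- A hypergraph $\mathcal H=(V,\mathcal E)$ consists of a vertex set $V$ and a set $\mathcal E$ of subsets of $V$, its hyperedges (so there are no multiple hyperedges); it is $5$-uniform if every hyperedge has exactly $5$ elements. Its edge intersection hypergraph is $$EI(\mathcal H)=\bigl(V,\{e_1\cap e_2 : e_1,e_2\in\mathcal E,\ e_1\ne e_2,\ |e_1\cap e_2|\ge 2\}\bigr).$$ Let $C_n$ be the cycle with vertex set $V=\{1,2,\dots,n\}$ (taken modulo $n$) and edge set $\{\{i,i+1\} : i\in V\}$. For $k\ge 1$, a $k$-section of $e\subseteq V$ is a sequence $(i,i+1,\dots,i+k-1)$ (modulo $n$) with $\{i,i+1,\dots,i+k-1\}\subseteq e$, $i-1\notin e$ and $i+k\notin e$. A hyperedge is a $(3,2)$-hyperedge if it consists of exactly two sections, a $3$-section and a $2$-section. **Theorem.** Let $n\ge 18$. Then there exists a $5$-uniform hypergraph $\mathcal H=(V,\mathcal E)$ with $EI(\mathcal H)=C_n$ and $|\mathcal E|=\left\lceil \frac{2n}{3}\right\rceil$ such that all but at most two of the hyperedges of $\mathcal H$ are $(3,2)$-hyperedges. -/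

import Mathlib

namespace EdgeIntersection

/-- `H` is `k`-uniform: every hyperedge has exactly `k` vertices. -/
def IsUniform {α : Type*} (H : Hypergraph α) (k : ℕ) : Prop :=
  ∀ e ∈ H.edgeSet, e.encard = k

/-- The edge intersection hypergraph `EI(H)`: it has the same vertices as `H`, and its hyperedges
are the intersections of two distinct hyperedges of `H` that have at least two elements. -/
def EI {α : Type*} (H : Hypergraph α) : Hypergraph α where
  vertexSet := H.vertexSet
  edgeSet := {s | ∃ e₁ ∈ H.edgeSet, ∃ e₂ ∈ H.edgeSet,
    e₁ ≠ e₂ ∧ 2 ≤ (e₁ ∩ e₂).encard ∧ s = e₁ ∩ e₂}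
  subset_vertexSet_of_mem_edgeSet' := by
    rintro s ⟨e₁, h₁, e₂, -, -, -, rfl⟩
    exact Set.inter_subset_left.trans (H.subset_vertexSet_of_mem_edgeSet' h₁)

/-- The cycle `C_n`, as a 2-uniform hypergraph: the vertices are the integers modulo `n` and the
edges are the pairs `{i, i + 1}`. -/
def cycle (n : ℕ) : Hypergraph (ZMod n) where
  vertexSet := Set.univ
  edgeSet := Set.range fun i : ZMod n => {i, i + 1}
  subset_vertexSet_of_mem_edgeSet' := fun _ _ => Set.subset_univ _

/-- The set `{i, i + 1, …, i + k - 1}` of vertices of `C_n`. -/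
def arc {n : ℕ} (i : ZMod n) (k : ℕ) : Set (ZMod n) :=
  {v | ∃ j : ℕ, j < k ∧ v = i + (j : ZMod n)}

/-- `(i, i + 1, …, i + k - 1)` is a `k`-section of `e` on `C_n`: a nonempty sequence of consecutive
vertices contained in `e` that can be extended in neither direction. -/
def IsSection {n : ℕ} (e : Set (ZMod n)) (i : ZMod n) (k : ℕ) : Prop :=
  1 ≤ k ∧ arc i k ⊆ e ∧ i - 1 ∉ e ∧ i + (k : ZMod n) ∉ e

/-- For `l = [l₁, …, l_t]`, the set `e` is an `(l₁, …, l_t)`-hyperedge: `t ≥ 1`, `l₁ ≥ … ≥ l_t`, and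
`e` consists of `t` distinct sections, whose lengths are `l₁, …, l_t`. (Distinct sections of `e`
have distinct initial vertices.) -/
def IsSectionHyperedge {n : ℕ} (e : Set (ZMod n)) (l : List ℕ) : Prop :=
  l ≠ [] ∧ l.Pairwise (fun a b => b ≤ a) ∧
    ∃ s : Fin l.length → ZMod n, Function.Injective s ∧
      (∀ j, IsSection e (s j) (l.get j)) ∧ e = ⋃ j, arc (s j) (l.get j)

end EdgeIntersection

/-!
Write `n = 3m + r` with `r < 3` and cut the cycle into the blocks `{3i, 3i + 1, 3i + 2}`, `i < m`,
followed by `r` remaining vertices. Reading block indices modulo `m`, take for every `i` the *inner*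
hyperedge `A i = {3i, 3i + 1, 3i + 2} ∪ {3(i + 3) + 1, 3(i + 3) + 2}` and the *bridge*
`B i = {3i + 2, 3i + 3, 3i + 4} ∪ {3(i + 2) + 2, 3(i + 2) + 3}`. If `r = 0`, then the edges
`{3i, 3i + 1}`, `{3i + 1, 3i + 2}` and `{3i + 2, 3i + 3}` of the cycle are `A i ∩ B (i - 1)`,
`A i ∩ A (i - 3)` and `B i ∩ B (i - 2)`. Conversely, `A i` and `B j` meet only if `i - j` is one of
`-3, …, 3`; these differences are distinct modulo `m` once `m ≥ 7`, and each of them alone produces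
at most one edge. If `r > 0`, one further *seam* hyperedge for each remaining vertex repairs the gap
between the last block and the first, so that there are `2m + r = ⌈2n / 3⌉` hyperedges in all.
-/

namespace EdgeIntersection

section Arcs

variable {n : ℕ}

theorem arc_two (i : ZMod n) : arc i 2 = {i, i + 1} := by
  ext v
  constructor
  · rintro ⟨j, hj, rfl⟩
    interval_cases j <;> simp
  · rintro (rfl | rfl)
    exacts [⟨0, by simp⟩, ⟨1, by simp⟩]

theorem encard_arc {k : ℕ} (hk : k ≤ n) (i : ZMod n) : (arc i k).encard = k := by
  have himage : arc i k = (fun j : ℕ => i + (j : ZMod n)) '' Finset.range k := by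
    ext v
    simp only [arc, Set.mem_ofPred_eq, Set.mem_image, Finset.coe_range, Set.mem_Iio, eq_comm]
  rw [himage, Set.InjOn.encard_image, Set.encard_coe_eq_coe_finsetCard, Finset.card_range]
  intro a ha b hb hab
  simp only [Finset.coe_range, Set.mem_Iio] at ha hb
  have hval := congrArg ZMod.val (add_left_cancel hab)
  rwa [ZMod.val_natCast_of_lt (by omega), ZMod.val_natCast_of_lt (by omega)] at hval

theorem isUniform_cycle (hn : 2 ≤ n) : IsUniform (cycle n) 2 := by
  rintro _ ⟨i, rfl⟩
  simp only [← arc_two, encard_arc hn]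

variable [NeZero n]

theorem mem_arc_iff {i v : ZMod n} {k : ℕ} : v ∈ arc i k ↔ (v - i).val < k := by
  constructor
  · rintro ⟨j, hj, rfl⟩
    rw [add_sub_cancel_left, ZMod.val_natCast]
    exact (Nat.mod_le j n).trans_lt hj
  · exact fun h => ⟨(v - i).val, h, by rw [ZMod.natCast_zmod_val, add_sub_cancel]⟩

instance (i : ZMod n) (k : ℕ) : DecidablePred (· ∈ arc i k) :=
  fun _ => decidable_of_iff _ mem_arc_iff.symm

end Arcs

section Sections

variable {n : ℕ} {e : Set (ZMod n)}

theorem IsSection.lt [NeZero n] {i : ZMod n} {k : ℕ} (h : IsSection e i k) : k < n := by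
  obtain ⟨-, hsub, hpred, -⟩ := h
  by_contra! hk
  exact hpred (hsub (mem_arc_iff.2 ((ZMod.val_lt _).trans_le hk)))

theorem IsSection.disjoint_arc {i j : ZMod n} {k l : ℕ} (hi : IsSection e i k)
    (hj : IsSection e j l) (hij : i ≠ j) : Disjoint (arc i k) (arc j l) := by
  obtain ⟨-, hi_sub, hi_pred, -⟩ := hi
  obtain ⟨-, hj_sub, hj_pred, -⟩ := hj
  rw [Set.disjoint_left]
  rintro _ ⟨a, ha, rfl⟩ ⟨b, hb, hab⟩
  rcases lt_trichotomy a b with hlt | rfl | hlt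
  · refine hi_pred (hj_sub ⟨b - a - 1, by omega, ?_⟩)
    rw [Nat.cast_sub (by omega), Nat.cast_sub hlt.le, Nat.cast_one]
    linear_combination hab
  · exact hij (add_right_cancel hab)
  · refine hj_pred (hi_sub ⟨a - b - 1, by omega, ?_⟩)
    rw [Nat.cast_sub (by omega), Nat.cast_sub hlt.le, Nat.cast_one]
    linear_combination -hab

theorem IsSectionHyperedge.encard_eq_sum [NeZero n] {l : List ℕ} (h : IsSectionHyperedge e l) :
    e.encard = l.sum := by
  obtain ⟨-, -, s, hs, hsec, he⟩ := h
  have hdisj : Pairwise (Function.onFun Disjoint fun j => arc (s j) (l.get j)) :=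
    fun i j hij => (hsec i).disjoint_arc (hsec j) (hs.ne hij)
  have hcard j : (arc (s j) (l.get j)).encard = (l.get j : ℕ) := encard_arc (hsec j).lt.le _
  rw [he, Set.encard_iUnion_of_finite hdisj, finsum_eq_sum_of_fintype]
  simp only [hcard, ← Nat.cast_sum]
  simp only [List.get_eq_getElem, Fin.sum_univ_getElem]

theorem isSection_arc_union_arc [NeZero n] {s t : ZMod n} {a b : ℕ} (ha : 1 ≤ a)
    (hst : a < (t - s).val) (hts : b < (s - t).val) : IsSection (arc s a ∪ arc t b) s a := by
  have hlt := ZMod.val_lt (t - s)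
  have : Fact (1 < n) := ⟨by omega⟩
  have hadd : (t - s).val + (s - t).val = n := by
    have hne : t - s ≠ 0 := fun h => by simp [h] at hst
    rw [← neg_sub t s, ZMod.neg_val, if_neg hne]
    omega
  refine ⟨ha, Set.subset_union_left, ?_, ?_⟩ <;>
    simp only [Set.mem_union, mem_arc_iff, not_or, not_lt]
  · constructor
    · rw [sub_sub_cancel_left, ZMod.neg_val, if_neg one_ne_zero, ZMod.val_one]
      omega
    · rw [sub_right_comm, ZMod.val_sub] <;> rw [ZMod.val_one] <;> omega
  · have ha_val : (a : ZMod n).val = a := ZMod.val_natCast_of_lt (by omega)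
    constructor
    · rw [add_sub_cancel_left, ha_val]
    · rw [add_sub_right_comm, ZMod.val_add_of_lt] <;> rw [ha_val] <;> omega

theorem isSectionHyperedge_arc_union_arc [NeZero n] {s t : ZMod n} {a b : ℕ} (hb : 1 ≤ b)
    (hba : b ≤ a) (hst : a < (t - s).val) (hts : b < (s - t).val) :
    IsSectionHyperedge (arc s a ∪ arc t b) [a, b] := by
  have hne : s ≠ t := fun h => by simp [h] at hst
  refine ⟨by simp, by simpa using hba, ![s, t], ?_, ?_, ?_⟩
  · intro i j hij
    fin_cases i <;> fin_cases j <;> simp_all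
  · intro j
    fin_cases j
    · exact isSection_arc_union_arc (hb.trans hba) hst hts
    · change IsSection _ t b
      rw [Set.union_comm]
      exact isSection_arc_union_arc hb hts hst
  · ext v
    simp [Fin.exists_fin_two]

end Sections

section Families

variable {α ι : Type*} {e : ι → Set α} {G : Hypergraph α}

/-- The hypergraph on all of `α` whose hyperedges are the members of the family `e`. -/
def ofFamily (e : ι → Set α) : Hypergraph α where
  vertexSet := Set.univ
  edgeSet := Set.range e
  subset_vertexSet_of_mem_edgeSet' := fun _ _ => Set.subset_univ _

theorem injective_of_inter_subset_edge {k : ℕ} (hG : IsUniform G k)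
    (hcard : ∀ i, k < (e i).encard)
    (hinter : ∀ i j, i ≠ j → ∃ f ∈ G.edgeSet, e i ∩ e j ⊆ f) : Function.Injective e := by
  intro i j hij
  by_contra hne
  obtain ⟨f, hf, hsub⟩ := hinter i j hne
  rw [← hij, Set.inter_self] at hsub
  exact (hcard i).not_ge (hG f hf ▸ Set.encard_le_encard hsub)

theorem EI_ofFamily_eq (hV : G.vertexSet = Set.univ) (hG : IsUniform G 2)
    (hcard : ∀ i, 2 < (e i).encard)
    (hinter : ∀ i j, i ≠ j → ∃ f ∈ G.edgeSet, e i ∩ e j ⊆ f)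
    (hcover : ∀ f ∈ G.edgeSet, ∃ i j, i ≠ j ∧ f ⊆ e i ∩ e j) : EI (ofFamily e) = G := by
  have hinj := injective_of_inter_subset_edge hG hcard hinter
  have eq_of_subset {A f : Set α} (hf : f ∈ G.edgeSet) (hA : 2 ≤ A.encard) (hAf : A ⊆ f) :
      A = f := by
    have hfin : f.Finite := Set.finite_of_encard_eq_coe (hG f hf)
    exact hfin.eq_of_subset_of_encard_le' hAf ((hG f hf).le.trans hA)
  refine Hypergraph.ext hV.symm (Set.Subset.antisymm ?_ ?_)
  · rintro _ ⟨_, ⟨i, rfl⟩, _, ⟨j, rfl⟩, hne, htwo, rfl⟩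
    obtain ⟨f, hf, hsub⟩ := hinter i j (ne_of_apply_ne e hne)
    exact eq_of_subset hf htwo hsub ▸ hf
  · intro f hf
    obtain ⟨i, j, hij, hsub⟩ := hcover f hf
    obtain ⟨g, hg, hsub'⟩ := hinter i j hij
    have htwo : 2 ≤ (e i ∩ e j).encard := (hG f hf).symm.trans_le (Set.encard_le_encard hsub)
    have hfg : f = g := eq_of_subset hg (hG f hf).ge (hsub.trans hsub')
    refine ⟨e i, ⟨i, rfl⟩, e j, ⟨j, rfl⟩, hinj.ne hij, htwo, ?_⟩
    rw [hfg, eq_of_subset hg htwo hsub']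

end Families

theorem ceil_two_mul_div_three (n : ℕ) : ⌈(2 * n : ℚ) / 3⌉₊ = (2 * n + 2) / 3 := by
  refine eq_of_forall_ge_iff fun c => ?_
  rw [Nat.ceil_le, div_le_iff₀ three_pos, Nat.div_le_iff_le_mul_add_pred three_pos]
  norm_cast
  omega

/-- The union of the arcs of lengths `3` and `2` with initial vertices `s` and `t`: the candidate
`(3, 2)`-hyperedge. -/
def arcPair {n : ℕ} (s t : ZMod n) : Set (ZMod n) := arc s 3 ∪ arc t 2

instance {n : ℕ} [NeZero n] (s t : ZMod n) : DecidablePred (· ∈ arcPair s t) :=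
  fun v => inferInstanceAs (Decidable (v ∈ arc s 3 ∪ arc t 2))

/-- The arcs of lengths `3` and `2` with initial vertices `s i` and `t i` form a family of
`(3, 2)`-hyperedges whose edge intersection hypergraph is the cycle. The separation condition says
that each arc ends at least one vertex before the other begins; the edge `{k, k + 1}` of the cycle
is written `arc k 2`. -/
structure IsArcSystem {n : ℕ} {ι : Type*} (s t : ι → ZMod n) : Prop where
  separated : ∀ i, 3 < (t i - s i).val ∧ 2 < (s i - t i).val
  exists_inter_subset : ∀ i j, i ≠ j →
    ∃ k, arcPair (s i) (t i) ∩ arcPair (s j) (t j) ⊆ arc k 2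
  exists_subset_inter : ∀ k, ∃ i j, i ≠ j ∧
    arc k 2 ⊆ arcPair (s i) (t i) ∩ arcPair (s j) (t j)

theorem IsArcSystem.exists_hypergraph {n : ℕ} {ι : Type*} [Fintype ι] {s t : ι → ZMod n}
    (hn : 2 ≤ n) (h : IsArcSystem s t) :
    ∃ H : Hypergraph (ZMod n), EI H = cycle n ∧ H.edgeSet.encard = Fintype.card ι ∧
      ∀ e ∈ H.edgeSet, IsSectionHyperedge e [3, 2] := by
  have : NeZero n := ⟨by omega⟩
  have hsec (i : ι) : IsSectionHyperedge (arcPair (s i) (t i)) [3, 2] :=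
    isSectionHyperedge_arc_union_arc one_le_two (Nat.le_succ 2) (h.separated i).1 (h.separated i).2
  have hcard (i : ι) : 2 < (arcPair (s i) (t i)).encard := by
    rw [(hsec i).encard_eq_sum]
    norm_num
  have hinter (i j : ι) (hij : i ≠ j) :
      ∃ f ∈ (cycle n).edgeSet, arcPair (s i) (t i) ∩ arcPair (s j) (t j) ⊆ f := by
    obtain ⟨k, hk⟩ := h.exists_inter_subset i j hij
    exact ⟨_, ⟨k, rfl⟩, hk.trans (arc_two k).subset⟩
  have hcover : ∀ f ∈ (cycle n).edgeSet, ∃ i j, i ≠ j ∧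
      f ⊆ arcPair (s i) (t i) ∩ arcPair (s j) (t j) := by
    rintro _ ⟨k, rfl⟩
    simpa only [arc_two] using h.exists_subset_inter k
  have hinj := injective_of_inter_subset_edge (isUniform_cycle hn) hcard hinter
  refine ⟨ofFamily fun i => arcPair (s i) (t i),
    EI_ofFamily_eq rfl (isUniform_cycle hn) hcard hinter hcover, ?_, ?_⟩
  · rw [ofFamily, ← Set.image_univ, hinj.encard_image, Set.encard_univ,
      ENat.card_eq_coe_fintype_card]
  · rintro _ ⟨i, rfl⟩
    exact hsec i

/-! For `18 ≤ n ≤ 20` there are six blocks, and the differences `-3` and `3` coincide. The matchings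
of `2`-sections to `3`-sections below were found by a computer search. -/

theorem isArcSystem_eighteen : IsArcSystem (n := 18)
    ![0, 2, 3, 5, 6, 8, 9, 11, 12, 14, 15, 17]
    ![14, 16, 13, 11, 2, 4, 17, 1, 8, 10, 7, 5] where
  separated := by decide +kernel
  exists_inter_subset := by simp only [Set.subset_def]; decide +kernel
  exists_subset_inter := by simp only [Set.subset_def]; decide +kernel

theorem isArcSystem_nineteen : IsArcSystem (n := 19)
    ![0, 2, 3, 5, 6, 8, 9, 11, 12, 14, 15, 17, 18]
    ![7, 10, 8, 11, 13, 17, 14, 16, 2, 4, 1, 5, 3] where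
  separated := by decide +kernel
  exists_inter_subset := by simp only [Set.subset_def]; decide +kernel
  exists_subset_inter := by simp only [Set.subset_def]; decide +kernel

theorem isArcSystem_twenty : IsArcSystem (n := 20)
    ![0, 2, 3, 5, 6, 8, 9, 11, 12, 14, 15, 17, 18, 19]
    ![11, 8, 10, 1, 16, 14, 17, 7, 5, 2, 4, 13, 3, 8] where
  separated := by decide +kernel
  exists_inter_subset := by simp only [Set.subset_def]; decide +kernel
  exists_subset_inter := by simp only [Set.subset_def]; decide +kernel

section Coordinates

/-- The vertex represented by `x < n` lies in the arc of length `k` whose initial vertex is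
represented by `a < n`. The second disjunct is the part of the arc that wraps around past
`n - 1`. -/
abbrev MemArc (n a k x : ℕ) : Prop := a ≤ x ∧ x < a + k ∨ x < a ∧ x + n < a + k

/-- Membership in `arcPair s t`, with all vertices represented by natural numbers below `n`. -/
abbrev MemArcPair (n s t x : ℕ) : Prop := MemArc n s 3 x ∨ MemArc n t 2 x

/-- The common vertices of `arcPair s t` and `arcPair s' t'` lie on a single edge of the cycle, with
all vertices represented by natural numbers below `n`. -/
def MeetInEdge (n s t s' t' : ℕ) : Prop :=
  ∃ k < n, ∀ x < n, MemArcPair n s t x → MemArcPair n s' t' x → MemArc n k 2 x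

variable {n : ℕ}

theorem MeetInEdge.symm {s t s' t' : ℕ} (h : MeetInEdge n s t s' t') : MeetInEdge n s' t' s t := by
  obtain ⟨k, hk, h⟩ := h
  exact ⟨k, hk, fun x hx hx₁ hx₂ => h x hx hx₂ hx₁⟩

theorem val_natCast_sub_natCast {a b : ℕ} (ha : a < n) (hb : b < n) :
    a ≤ b ∧ ((b : ZMod n) - a).val = b - a ∨ b < a ∧ ((b : ZMod n) - a).val = b + n - a := by
  rcases le_or_gt a b with h | h
  · refine .inl ⟨h, ?_⟩
    rw [← Nat.cast_sub h, ZMod.val_natCast_of_lt (by omega)]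
  · refine .inr ⟨h, ?_⟩
    have hcast : (b : ZMod n) - a = (b + n - a : ℕ) := by
      rw [Nat.cast_sub (by omega), Nat.cast_add, ZMod.natCast_self, add_zero]
    rw [hcast, ZMod.val_natCast_of_lt (by omega)]

variable [NeZero n]

theorem mem_arc_natCast_iff {a k : ℕ} (ha : a < n) {v : ZMod n} :
    v ∈ arc (a : ZMod n) k ↔ MemArc n a k v.val := by
  have hval := val_natCast_sub_natCast ha v.val_lt
  rw [ZMod.natCast_zmod_val] at hval
  rw [mem_arc_iff]
  omega

theorem mem_arcPair_natCast_iff {s t : ℕ} (hs : s < n) (ht : t < n) {v : ZMod n} :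
    v ∈ arcPair (s : ZMod n) (t : ZMod n) ↔ MemArcPair n s t v.val := by
  rw [arcPair, Set.mem_union, mem_arc_natCast_iff hs, mem_arc_natCast_iff ht]

theorem isArcSystem_natCast {ι : Type*} {s t : ι → ℕ} (hs : ∀ i, s i < n) (ht : ∀ i, t i < n)
    (hsep : ∀ i, s i + 4 ≤ t i ∧ t i + 3 ≤ s i + n ∨ t i + 3 ≤ s i ∧ s i + 4 ≤ t i + n)
    (hmeet : ∀ i j, i ≠ j → MeetInEdge n (s i) (t i) (s j) (t j))
    (hcover : ∀ k < n, ∃ i j, i ≠ j ∧ ∀ x < n, MemArc n k 2 x →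
      MemArcPair n (s i) (t i) x ∧ MemArcPair n (s j) (t j) x) :
    IsArcSystem (fun i => (s i : ZMod n)) (fun i => (t i : ZMod n)) where
  separated i := by
    have := hsep i
    have := val_natCast_sub_natCast (hs i) (ht i)
    have := val_natCast_sub_natCast (ht i) (hs i)
    omega
  exists_inter_subset i j hij := by
    obtain ⟨k, hk, h⟩ := hmeet i j hij
    refine ⟨k, fun v hv => ?_⟩
    rw [Set.mem_inter_iff, mem_arcPair_natCast_iff (hs i) (ht i),
      mem_arcPair_natCast_iff (hs j) (ht j)] at hv
    rw [mem_arc_natCast_iff hk]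
    exact h v.val v.val_lt hv.1 hv.2
  exists_subset_inter k := by
    obtain ⟨i, j, hij, h⟩ := hcover k.val k.val_lt
    refine ⟨i, j, hij, fun v hv => ?_⟩
    rw [← ZMod.natCast_zmod_val k, mem_arc_natCast_iff k.val_lt] at hv
    rw [Set.mem_inter_iff, mem_arcPair_natCast_iff (hs i) (ht i),
      mem_arcPair_natCast_iff (hs j) (ht j)]
    exact h v.val v.val_lt hv

end Coordinates

section Blocks

/-- The index of the block that is `c` blocks after block `i`, among the `n / 3` blocks
`{3i, 3i + 1, 3i + 2}`, cyclically. -/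
def blockShift (n c i : ℕ) : ℕ := (i + c) % (n / 3)

variable {n c i j p q : ℕ}

theorem blockShift_spec (hi : i < n / 3) (hc : c ≤ n / 3) :
    blockShift n c i < n / 3 ∧
      (blockShift n c i = i + c ∨ blockShift n c i + n / 3 = i + c) := by
  refine ⟨Nat.mod_lt _ (by omega), ?_⟩
  rw [blockShift]
  rcases lt_or_ge (i + c) (n / 3) with h | h
  · rw [Nat.mod_eq_of_lt h]; omega
  · rw [Nat.mod_eq_sub_mod h, Nat.mod_eq_of_lt (by omega)]; omega

theorem exists_blockShift_eq (hi : i < n / 3) (hc : c ≤ n / 3) :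
    ∃ j < n / 3, blockShift n c j = i := by
  have hj := blockShift_spec hi (Nat.sub_le (n / 3) c)
  have hshift := blockShift_spec hj.1 hc
  exact ⟨_, hj.1, by omega⟩

theorem meetInEdge_inner_inner (hn : 21 ≤ n) (hi : i < n / 3) (hj : j < n / 3) (hij : i ≠ j) :
    MeetInEdge n (3 * i) (3 * blockShift n 3 i + 1) (3 * j) (3 * blockShift n 3 j + 1) := by
  have hi_shift := blockShift_spec (c := 3) hi (by omega)
  have hj_shift := blockShift_spec (c := 3) hj (by omega)
  by_cases h : blockShift n 3 i = j
  · exact ⟨3 * j + 1, by omega, fun x _ _ _ => by omega⟩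
  · exact ⟨3 * i + 1, by omega, fun x _ _ _ => by omega⟩

theorem meetInEdge_bridge_bridge (hn : 21 ≤ n) (hi : i < n / 3) (hj : j < n / 3) (hij : i ≠ j) :
    MeetInEdge n (3 * i + 2) (3 * blockShift n 2 i + 2) (3 * j + 2) (3 * blockShift n 2 j + 2) := by
  have hi_shift := blockShift_spec (c := 2) hi (by omega)
  have hj_shift := blockShift_spec (c := 2) hj (by omega)
  by_cases h : blockShift n 2 i = j
  · exact ⟨3 * j + 2, by omega, fun x _ _ _ => by omega⟩
  · exact ⟨3 * i + 2, by omega, fun x _ _ _ => by omega⟩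

-- Modulo `n / 3`, the first case is `i - j ∈ {0, 2}`, the second is `i - j ∈ {1, 3}`, and the third
-- includes `i - j ∈ {-3, -2, -1}`.
theorem meetInEdge_inner_bridge (hn : 21 ≤ n) (hi : i < n / 3) (hj : j < n / 3) :
    MeetInEdge n (3 * i) (3 * blockShift n 3 i + 1) (3 * j + 2) (3 * blockShift n 2 j + 2) := by
  have hi_shift := blockShift_spec (c := 3) hi (by omega)
  have hj_shift := blockShift_spec (c := 2) hj (by omega)
  have hj_succ := blockShift_spec (c := 1) hj (by omega)
  have hj_shift_succ := blockShift_spec (c := 3) hj (by omega)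
  by_cases h_even : i = j ∨ i = blockShift n 2 j
  · exact ⟨3 * i + 1, by omega, fun x _ _ _ => by omega⟩
  by_cases h_odd : i = blockShift n 1 j ∨ i = blockShift n 3 j
  · exact ⟨3 * i, by omega, fun x _ _ _ => by omega⟩
  · exact ⟨3 * blockShift n 3 i + 1, by omega, fun x _ _ _ => by omega⟩

theorem meetInEdge_inner_seam (hn : 21 ≤ n) (hi : i < n / 3) (hq : q < n % 3) :
    MeetInEdge n (3 * i) (3 * blockShift n 3 i + 1) (3 * (n / 3) + q) (3 + 4 * q) := by
  have hi_shift := blockShift_spec (c := 3) hi (by omega)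
  by_cases h : i = 0 ∨ blockShift n 3 i = 0
  · exact ⟨0, by omega, fun x _ _ _ => by omega⟩
  · exact ⟨3 + 4 * q, by omega, fun x _ _ _ => by omega⟩

theorem meetInEdge_bridge_seam (hn : 21 ≤ n) (hj : j < n / 3) (hq : q < n % 3) :
    MeetInEdge n (3 * j + 2) (3 * blockShift n 2 j + 2) (3 * (n / 3) + q) (3 + 4 * q) := by
  have hj_shift := blockShift_spec (c := 2) hj (by omega)
  by_cases h : j + 1 = n / 3 ∨ blockShift n 2 j + 1 = n / 3
  · exact ⟨3 * (n / 3) + q, by omega, fun x _ _ _ => by omega⟩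
  · exact ⟨3 + 4 * q, by omega, fun x _ _ _ => by omega⟩

theorem meetInEdge_seam_seam (hn : 21 ≤ n) (hp : p < n % 3) (hq : q < n % 3) (hpq : p ≠ q) :
    MeetInEdge n (3 * (n / 3) + p) (3 + 4 * p) (3 * (n / 3) + q) (3 + 4 * q) :=
  ⟨3 * (n / 3) + 1, by omega, fun x _ _ _ => by omega⟩

/-- The initial vertices of the `3`-sections of the inner, bridge and seam hyperedges. -/
def tripleStart (n : ℕ) : Fin (n / 3) ⊕ Fin (n / 3) ⊕ Fin (n % 3) → ℕ
  | .inl i => 3 * i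
  | .inr (.inl j) => 3 * j + 2
  | .inr (.inr q) => 3 * (n / 3) + q

/-- The initial vertices of the `2`-sections of the inner, bridge and seam hyperedges. Those of the
seam hyperedges merely have to keep clear of all other intersections. -/
def doubleStart (n : ℕ) : Fin (n / 3) ⊕ Fin (n / 3) ⊕ Fin (n % 3) → ℕ
  | .inl i => 3 * blockShift n 3 i + 1
  | .inr (.inl j) => 3 * blockShift n 2 j + 2
  | .inr (.inr q) => 3 + 4 * q

theorem meetInEdge_tripleStart_doubleStart (hn : 21 ≤ n)
    {x y : Fin (n / 3) ⊕ Fin (n / 3) ⊕ Fin (n % 3)} (hxy : x ≠ y) :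
    MeetInEdge n (tripleStart n x) (doubleStart n x) (tripleStart n y) (doubleStart n y) := by
  rcases x with i | i | p <;> rcases y with j | j | q
  · exact meetInEdge_inner_inner hn i.isLt j.isLt fun h => hxy (by rw [Fin.ext h])
  · exact meetInEdge_inner_bridge hn i.isLt j.isLt
  · exact meetInEdge_inner_seam hn i.isLt q.isLt
  · exact (meetInEdge_inner_bridge hn j.isLt i.isLt).symm
  · exact meetInEdge_bridge_bridge hn i.isLt j.isLt fun h => hxy (by rw [Fin.ext h])
  · exact meetInEdge_bridge_seam hn i.isLt q.isLt
  · exact (meetInEdge_inner_seam hn j.isLt p.isLt).symm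
  · exact (meetInEdge_bridge_seam hn j.isLt p.isLt).symm
  · exact meetInEdge_seam_seam hn p.isLt q.isLt fun h => hxy (by rw [Fin.ext h])

theorem exists_memArcPair_of_memArc_two (hn : 21 ≤ n) {k : ℕ} (hk : k < n) :
    ∃ i j, i ≠ j ∧ ∀ x < n, MemArc n k 2 x →
      MemArcPair n (tripleStart n i) (doubleStart n i) x ∧
        MemArcPair n (tripleStart n j) (doubleStart n j) x := by
  have hblock : (∃ a < n / 3, k = 3 * a ∨ k = 3 * a + 1 ∨ k = 3 * a + 2) ∨
      k = 3 * (n / 3) ∨ k = 3 * (n / 3) + 1 := by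
    by_cases h : k / 3 < n / 3
    · exact .inl ⟨k / 3, h, by omega⟩
    · omega
  obtain ⟨a, ha, rfl | rfl | rfl⟩ | rfl | rfl := hblock
  · rcases Nat.eq_zero_or_pos a with rfl | hpos
    · rcases Nat.eq_zero_or_pos (n % 3) with hr | hr
      · refine ⟨.inl ⟨0, ha⟩, .inr (.inl ⟨n / 3 - 1, by omega⟩), Sum.inl_ne_inr, ?_⟩
        simp only [tripleStart, doubleStart]
        omega
      · refine ⟨.inl ⟨0, ha⟩, .inr (.inr ⟨n % 3 - 1, by omega⟩), Sum.inl_ne_inr, ?_⟩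
        simp only [tripleStart, doubleStart]
        omega
    · refine ⟨.inl ⟨a, ha⟩, .inr (.inl ⟨a - 1, by omega⟩), Sum.inl_ne_inr, ?_⟩
      simp only [tripleStart, doubleStart]
      omega
  · obtain ⟨i, hi, hshift⟩ := exists_blockShift_eq (c := 3) ha (by omega)
    have hi_shift := blockShift_spec (c := 3) hi (by omega)
    have hne : a ≠ i := by omega
    refine ⟨.inl ⟨a, ha⟩, .inl ⟨i, hi⟩, by simpa using hne, ?_⟩
    simp only [tripleStart, doubleStart]
    omega
  · obtain ⟨i, hi, hshift⟩ := exists_blockShift_eq (c := 2) ha (by omega)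
    have hi_shift := blockShift_spec (c := 2) hi (by omega)
    have hne : a ≠ i := by omega
    refine ⟨.inr (.inl ⟨a, ha⟩), .inr (.inl ⟨i, hi⟩), by simpa using hne, ?_⟩
    simp only [tripleStart, doubleStart]
    omega
  · refine ⟨.inr (.inl ⟨n / 3 - 1, by omega⟩), .inr (.inr ⟨0, by omega⟩), by simp, ?_⟩
    simp only [tripleStart, doubleStart]
    omega
  · refine ⟨.inr (.inr ⟨0, by omega⟩), .inr (.inr ⟨1, by omega⟩), by simp, ?_⟩
    simp only [tripleStart, doubleStart]
    omega

theorem isArcSystem_of_twentyone_le [NeZero n] (hn : 21 ≤ n) :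
    IsArcSystem (fun x => (tripleStart n x : ZMod n)) (fun x => (doubleStart n x : ZMod n)) := by
  have hinner (i : Fin (n / 3)) := blockShift_spec (c := 3) i.isLt (by omega)
  have hbridge (j : Fin (n / 3)) := blockShift_spec (c := 2) j.isLt (by omega)
  refine isArcSystem_natCast ?_ ?_ ?_ (fun _ _ => meetInEdge_tripleStart_doubleStart hn)
    (fun _ => exists_memArcPair_of_memArc_two hn)
  all_goals
    rintro (i | j | q)
    · have := hinner i
      simp only [tripleStart, doubleStart]
      omega
    · have := hbridge j
      simp only [tripleStart, doubleStart]
      omega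
    · simp only [tripleStart, doubleStart]
      omega

end Blocks

end EdgeIntersection

open EdgeIntersection in
theorem theorem4p5_general (n : ℕ) (hn : 18 ≤ n) :
    ∃ H : Hypergraph (ZMod n),
      EI H = cycle n ∧
      H.edgeSet.encard = (⌈(2 * n : ℚ) / 3⌉₊ : ℕ) ∧
      ∀ e ∈ H.edgeSet, IsSectionHyperedge e [3, 2] := by
  have : NeZero n := ⟨by omega⟩
  rw [ceil_two_mul_div_three]
  obtain rfl | rfl | rfl | hn : n = 18 ∨ n = 19 ∨ n = 20 ∨ 21 ≤ n := by omega
  · simpa using isArcSystem_eighteen.exists_hypergraph (by norm_num)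
  · simpa using isArcSystem_nineteen.exists_hypergraph (by norm_num)
  · simpa using isArcSystem_twenty.exists_hypergraph (by norm_num)
  · have hcard : Fintype.card (Fin (n / 3) ⊕ Fin (n / 3) ⊕ Fin (n % 3)) = (2 * n + 2) / 3 := by
      simp only [Fintype.card_sum, Fintype.card_fin]
      omega
    rw [← hcard]
    exact (isArcSystem_of_twentyone_le hn).exists_hypergraph (by omega)

theorem theorem4p5 (n : ℕ) (hn : 18 ≤ n) :
    ∃ H : Hypergraph (ZMod n),
      EdgeIntersection.IsUniform H 5 ∧
      EdgeIntersection.EI H = EdgeIntersection.cycle n ∧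
      H.edgeSet.encard = (⌈(2 * n : ℚ) / 3⌉₊ : ℕ) ∧
      {e ∈ H.edgeSet | ¬ EdgeIntersection.IsSectionHyperedge e [3, 2]}.encard ≤ 2 := by
  have : NeZero n := ⟨by omega⟩
  obtain ⟨H, hEI, hcard, hsec⟩ := theorem4p5_general n hn
  have hexc : {e ∈ H.edgeSet | ¬ EdgeIntersection.IsSectionHyperedge e [3, 2]} = ∅ :=
    Set.eq_empty_of_forall_notMem fun e he => he.2 (hsec e he.1)
  exact ⟨H, fun e he => (hsec e he).encard_eq_sum, hEI, hcard, by simp [hexc]⟩
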